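/- Call a finite simple graph a triangle-tree if it can be obtained, up to isomorphism, by the following recursive rule: a single triangle is a triangle-tree, and if $H$ is a triangle-tree, then so is every graph obtained from $H$ and a new disjoint triangle by identifying a single vertex of the new triangle with a vertex of $H$, or by identifying an edge of the new triangle with an edge of $H$. For a finite graph $H$ with $v(H)$ vertices and $e(H)$ edges, let $M(H;n)$ be the minimum, over all 2-edge-colourings of the complete graph $K_n$, of the number of labelled monochromatic copies of $H$, that is, of injective maps $V(H)\to V(K_n)$ sending all edges of $H$ to edges of one and the same colour. The graph $H$ is common if $$C(H):=\lim_{n\to\infty}\frac{M(H;n)}{n(n-1)\cdots(n-v(H)+1)}=2^{1-e(H)}.$$ Theorem 1.1. Every triangle-tree is common; that is, for every triangle-tree $H$ the limit $C(H)$ exists and equals $2^{1-e(H)}$. -/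

import Mathlib

open Filter Topology

universe u

namespace SimpleGraph

/-- The graph obtained from `H` by gluing a new triangle along the single vertex `w`: the two
vertices `Sum.inr 0`, `Sum.inr 1` are new, and `w` together with them spans the new triangle. -/
def glueTriangleAtVertex {V : Type u} (H : SimpleGraph V) (w : V) : SimpleGraph (V ⊕ Fin 2) :=
  H.map (Sum.inl : V → V ⊕ Fin 2) ⊔
    fromEdgeSet {s(Sum.inl w, Sum.inr 0), s(Sum.inl w, Sum.inr 1), s(Sum.inr 0, Sum.inr 1)}

/-- The graph obtained from `H` by gluing a new triangle along the pair `x`, `y` (which will be an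
edge of `H`): the vertex `none` is new and is joined exactly to `x` and `y`. -/
def glueTriangleAtEdge {V : Type u} (H : SimpleGraph V) (x y : V) : SimpleGraph (Option V) :=
  H.map (some : V → Option V) ⊔
    fromEdgeSet {s(none, some x), s(none, some y)}

/-- Triangle-trees (up to isomorphism): a triangle is a triangle-tree, and so is every graph
obtained from a triangle-tree by identifying a vertex of a new triangle with a vertex of it, or an
edge of a new triangle with an edge of it. -/
inductive IsTriangleTree : {V : Type u} → SimpleGraph V → Prop
  | triangle {V : Type u} {H : SimpleGraph V}
      (e : (⊤ : SimpleGraph (Fin 3)) ≃g H) : IsTriangleTree H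
  | glueVertex {V V' : Type u} {H : SimpleGraph V} {H' : SimpleGraph V'}
      (hH : IsTriangleTree H) (w : V) (e : H.glueTriangleAtVertex w ≃g H') : IsTriangleTree H'
  | glueEdge {V V' : Type u} {H : SimpleGraph V} {H' : SimpleGraph V'}
      (hH : IsTriangleTree H) (x y : V) (hxy : H.Adj x y)
      (e : H.glueTriangleAtEdge x y ≃g H') : IsTriangleTree H'

/-- The number of labelled monochromatic copies of `H` in the 2-edge-colouring `C` of `K_n`:
injective maps from the vertices of `H` that send all edges of `H` to edges of one colour.
(`C.labelGraph c` is the graph of edges of colour `c`.) -/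
noncomputable def monoCopyCount {V : Type u} (H : SimpleGraph V) {n : ℕ}
    (C : TopEdgeLabeling (Fin n) (Fin 2)) : ℕ :=
  Nat.card {f : V ↪ Fin n // ∃ c : Fin 2, ∀ u v : V, H.Adj u v → (C.labelGraph c).Adj (f u) (f v)}

/-- The Ramsey multiplicity `M(H; n)`: the minimum number of labelled monochromatic copies of `H`
over all 2-edge-colourings of `K_n`. -/
noncomputable def ramseyMultiplicity {V : Type u} (H : SimpleGraph V) (n : ℕ) : ℕ :=
  ⨅ C : TopEdgeLabeling (Fin n) (Fin 2), H.monoCopyCount C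

/-- A finite graph `H` with `v` vertices and `e` edges is common if its Ramsey multiplicity constant
`C(H) = lim M(H; n) / (n (n - 1) ⋯ (n - v + 1))` equals `2 ^ (1 - e)`. -/
def IsCommon {V : Type u} [Finite V] (H : SimpleGraph V) : Prop :=
  Tendsto (fun n : ℕ => (H.ramseyMultiplicity n : ℝ) / (n.descFactorial (Nat.card V) : ℝ))
    atTop (𝓝 ((2 : ℝ) ^ (1 - (H.edgeSet.ncard : ℤ))))

end SimpleGraph

/-! Upper bound: in a uniformly random colouring, a fixed embedding of `H` is monochromatic in a
given colour with probability at most `2^{-e(H)}`, and the minimum is at most the mean.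

Lower bound: let `G` be one colour class on `n` vertices, with `T` ordered triangles and `E` ordered
edges, and let `H` be built from `m` triangles with `b` edge gluings, so `e(H) = 3m - b` and `v(H) =
2m + 1 - b`. A random map from `H` to `G` is grown triangle by triangle: the first triangle is
uniform, and each later one is uniform among the triangles on the image of the glued vertex or edge,
conditionally on it alone. Every edge of `H` keeps the marginal of a uniform triangle, so a gluing
adds entropy at least `log T - log n` or `log T - log E` (`entropy_extend`). Since entropy is at
most the logarithm of the support size, `hom(H,G) ≥ T^m / (n^(m-1-b) E^b)`.

With `X = 8T/n³` and `Y = 2E/n²`, the homomorphism density is therefore at least `2^{-e(H)} X^m /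
Y^b`, and `X^m / Y^b` lies above its tangent plane at `(1,1)`. That plane is increasing in `X` and
nonincreasing in `Y`. Adding the bounds for `G` and its complement, Goodman's inequality controls
the sum of the `X` and disjointness of edges that of the `Y`. Non-injective maps are of lower order.
-/

/-! ### Entropy inequalities. -/

-- Log-sum inequality. It is used both to bound the conditional entropy gained by a gluing and, with
-- `T = 1`, to bound entropy by the log of the support size.
open Real in
theorem Finset.sum_mul_log_ge {γ : Type*} [Fintype γ] (S : Finset γ) (D : γ → ℝ) (T : ℝ)
    (hD : ∀ y, 0 ≤ D y) (hS : ∀ y, D y ≠ 0 → y ∈ S) (hT : ∑ y, D y = T) (hpos : 0 < T) :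
    T * (log T - log S.card) ≤ ∑ y, D y * log (D y) := by
  have hsub (F : γ → ℝ) (hF : ∀ y, D y = 0 → F y = 0) : ∑ y, F y = ∑ y ∈ S, F y := by
    refine (Finset.sum_subset (Finset.subset_univ S) fun y _ hy => hF y ?_).symm
    by_contra h
    exact hy (hS y h)
  have hTS : ∑ y ∈ S, D y = T := by rw [← hsub D fun y h => h, hT]
  have hcard : (0 : ℝ) < S.card := by
    rcases S.eq_empty_or_nonempty with h | h
    · simp [h] at hTS; linarith
    · exact_mod_cast h.card_pos
  set c := T / S.card with hc
  have hcpos : 0 < c := by positivity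
  -- Tangent line of the convex function `x log x` at the mean value `c`.
  have key : ∀ y ∈ S, D y * log c + D y - c ≤ D y * log (D y) := by
    intro y _
    rcases (hD y).eq_or_lt with h | h
    · rw [← h]; simp [hcpos.le]
    · have h1 := log_le_sub_one_of_pos (div_pos hcpos h)
      rw [log_div hcpos.ne' h.ne'] at h1
      have h2 := mul_le_mul_of_nonneg_left h1 h.le
      have h3 : D y * (c / D y - 1) = c - D y := by field_simp
      nlinarith
  have hsum := Finset.sum_le_sum key
  rw [Finset.sum_sub_distrib, Finset.sum_add_distrib, ← Finset.sum_mul, hTS, Finset.sum_const,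
    nsmul_eq_mul, ← hsub (fun y => D y * log (D y)) fun y h => by simp [h]] at hsum
  have h4 : (S.card : ℝ) * c = T := by rw [hc]; field_simp
  rw [← log_div hpos.ne' hcard.ne']
  linarith

namespace Real

variable {Ω β : Type*} [Fintype Ω] [Fintype β]

theorem sum_mul_div_sum (p : ℝ) (t : β → ℝ) (h : p ≠ 0 → ∑ b, t b ≠ 0) :
    ∑ b, p * (t b / ∑ b', t b') = p := by
  rw [← Finset.mul_sum, ← Finset.sum_div]
  by_cases hp : p = 0
  · simp [hp]
  · rw [div_self (h hp), mul_one]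

theorem sum_negMulLog_uniform (t : β → ℝ) (ht : ∀ b, t b = 0 ∨ t b = 1) (h : ∑ b, t b ≠ 0) :
    ∑ b, negMulLog (t b / ∑ b', t b') = log (∑ b, t b) := by
  have h1 : ∀ b, negMulLog (t b / ∑ b', t b') = t b * (log (∑ b', t b') / ∑ b', t b') := by
    intro b
    rcases ht b with h | h <;> simp [h, negMulLog]
    ring
  rw [Finset.sum_congr rfl fun b _ => h1 b, ← Finset.sum_mul]
  field_simp

/-- Chain rule: a conditionally uniform choice adds the expected log of the number of options. -/
theorem sum_negMulLog_extend (p : Ω → ℝ) (t : Ω → β → ℝ) (ht : ∀ ω b, t ω b = 0 ∨ t ω b = 1)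
    (h : ∀ ω, p ω ≠ 0 → ∑ b, t ω b ≠ 0) :
    ∑ x : Ω × β, negMulLog (p x.1 * (t x.1 x.2 / ∑ b, t x.1 b)) =
      ∑ ω, negMulLog (p ω) + ∑ ω, p ω * log (∑ b, t ω b) := by
  rw [Fintype.sum_prod_type, ← Finset.sum_add_distrib]
  refine Finset.sum_congr rfl fun ω _ => ?_
  by_cases hp : p ω = 0
  · simp [hp]
  simp only [negMulLog_mul]
  rw [Finset.sum_add_distrib, ← Finset.sum_mul, ← Finset.mul_sum,
    sum_negMulLog_uniform _ (ht ω) (h ω hp), ← Finset.sum_div, div_self (h ω hp), one_mul]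

end Real

namespace SimpleGraph

/-! ### Symmetry of the ordered triangle count. -/

section Triangle

variable {N : Type}

open Classical in
/-- The indicator of `a`, `b`, `c` spanning a triangle. -/
noncomputable def triangleInd (G : SimpleGraph N) (a b c : N) : ℝ :=
  if G.Adj a b ∧ G.Adj a c ∧ G.Adj b c then 1 else 0

variable (G : SimpleGraph N)

theorem triangleInd_eq (a b c : N) : G.triangleInd a b c = 0 ∨ G.triangleInd a b c = 1 := by
  unfold triangleInd; split_ifs <;> simp

theorem triangleInd_nonneg (a b c : N) : 0 ≤ G.triangleInd a b c := by
  unfold triangleInd; split_ifs <;> simp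

theorem triangleInd_swap_left (a b c : N) : G.triangleInd a b c = G.triangleInd b a c := by
  unfold triangleInd
  congr 1
  simp only [G.adj_comm a b, eq_iff_iff]
  tauto

theorem triangleInd_swap_right (a b c : N) : G.triangleInd a b c = G.triangleInd a c b := by
  unfold triangleInd
  congr 1
  simp only [G.adj_comm b c, eq_iff_iff]
  tauto

variable [Fintype N]

/-- The number of ordered triangles. -/
noncomputable def triangleSum : ℝ := ∑ a, ∑ b, ∑ c, G.triangleInd a b c

theorem sum_triangleInd_swap_left (F : N → N → N → ℝ) :
    ∑ a, ∑ b, ∑ c, G.triangleInd a b c * F a b c = ∑ a, ∑ b, ∑ c, G.triangleInd a b c * F b a c := by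
  rw [Finset.sum_comm]
  simp only [fun a b c => G.triangleInd_swap_left b a c]

theorem sum_triangleInd_swap_right (F : N → N → N → ℝ) :
    ∑ a, ∑ b, ∑ c, G.triangleInd a b c * F a b c = ∑ a, ∑ b, ∑ c, G.triangleInd a b c * F a c b := by
  refine Finset.sum_congr rfl fun a _ => ?_
  rw [Finset.sum_comm]
  simp only [fun b c => G.triangleInd_swap_right a c b]

/-- The triangle marginal on any ordered edge of the triangle is the same. -/
theorem sum_triangleInd_edge (g : N → N → ℝ) {i j : Fin 3} (hij : i ≠ j) :
    ∑ a, ∑ b, ∑ c, G.triangleInd a b c * g (![a, b, c] i) (![a, b, c] j) =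
      ∑ a, ∑ b, ∑ c, G.triangleInd a b c * g a b := by
  have h01 := G.sum_triangleInd_swap_left fun a b _ => g a b
  have h02 := G.sum_triangleInd_swap_right fun a b _ => g a b
  have h20 := G.sum_triangleInd_swap_right fun a b _ => g b a
  have h12 := G.sum_triangleInd_swap_left fun a _ c => g a c
  have h21 := G.sum_triangleInd_swap_left fun a _ c => g c a
  fin_cases i <;> fin_cases j <;> first | exact absurd rfl hij | skip
  all_goals simp at h01 h02 h20 h12 h21 ⊢
  all_goals linarith

end Triangle

/-! ### Growing random maps by gluing triangles. -/

section Model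

variable {N : Type} [Fintype N]

/-- There is a finite probability space carrying a random map from the vertices of `H` to those of
`G` with entropy at least `s`, such that every edge of `H` is distributed like an edge of a
uniformly random triangle of `G`. -/
def HasTriangleModel {V : Type u} (H : SimpleGraph V) (G : SimpleGraph N) (s : ℝ) : Prop :=
  ∃ (Ω : Type) (_ : Fintype Ω) (p : Ω → ℝ) (X : V → Ω → N),
    (∀ ω, 0 ≤ p ω) ∧ ∑ ω, p ω = 1 ∧ Function.Injective (fun ω v => X v ω) ∧
    (∀ u v, H.Adj u v → ∀ g : N → N → ℝ,
      G.triangleSum * ∑ ω, p ω * g (X u ω) (X v ω) =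
        ∑ a, ∑ b, ∑ c, G.triangleInd a b c * g a b) ∧
    s ≤ ∑ ω, Real.negMulLog (p ω)

variable {V : Type u} {H : SimpleGraph V} {G : SimpleGraph N} {s : ℝ}

theorem HasTriangleModel.iso {W : Type*} {H' : SimpleGraph W} (h : H.HasTriangleModel G s)
    (e : H ≃g H') :
    H'.HasTriangleModel G s := by
  obtain ⟨Ω, _, p, X, hp, hp1, hX, hm, hs⟩ := h
  refine ⟨Ω, ‹_›, p, fun v => X (e.symm v), hp, hp1, fun ω ω' h => hX ?_, fun u v huv =>
    hm _ _ (e.symm.map_rel_iff.2 huv), hs⟩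
  funext v
  simpa using congrFun h (e v)

theorem hasTriangleModel_triangle (hT : 0 < G.triangleSum) :
    (⊤ : SimpleGraph (Fin 3)).HasTriangleModel G (Real.log G.triangleSum) := by
  have hsum : ∑ x : N × N × N, G.triangleInd x.1 x.2.1 x.2.2 = G.triangleSum := by
    simp only [Fintype.sum_prod_type, triangleSum]
  refine ⟨N × N × N, inferInstance, fun x => G.triangleInd x.1 x.2.1 x.2.2 / G.triangleSum,
    fun i x => ![x.1, x.2.1, x.2.2] i, fun x => div_nonneg (G.triangleInd_nonneg _ _ _) hT.le,
    by rw [← Finset.sum_div, hsum, div_self hT.ne'], ?_, ?_, ?_⟩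
  · rintro ⟨a, b, c⟩ ⟨a', b', c'⟩ h
    have h0 := congrFun h 0
    have h1 := congrFun h 1
    have h2 := congrFun h 2
    simp at h0 h1 h2
    simp [h0, h1, h2]
  · intro i j hij g
    rw [← G.sum_triangleInd_edge g hij.ne, Finset.mul_sum]
    simp only [Fintype.sum_prod_type]
    refine Finset.sum_congr rfl fun a _ => Finset.sum_congr rfl fun b _ =>
      Finset.sum_congr rfl fun c _ => ?_
    field_simp
  · have := Real.sum_negMulLog_uniform (fun x : N × N × N => G.triangleInd x.1 x.2.1 x.2.2)
      (fun _ => G.triangleInd_eq _ _ _) (by rw [hsum]; exact hT.ne')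
    rw [hsum] at this
    exact this.ge

/-- Extending a model by a conditionally uniform choice of `b` with `t (Y ω) b = 1`, when `Y` has
the marginal distribution of `t`. -/
theorem entropy_extend {Ω β γ : Type} [Fintype Ω] [Fintype β] [Fintype γ] {p : Ω → ℝ} {T : ℝ}
    (hT : 0 < T) (hp : ∀ ω, 0 ≤ p ω) (Y : Ω → γ) (t : γ → β → ℝ)
    (ht : ∀ y b, t y b = 0 ∨ t y b = 1)
    (hY : ∀ g : γ → ℝ, T * ∑ ω, p ω * g (Y ω) = ∑ y, (∑ b, t y b) * g y)
    (hsum : ∑ y, ∑ b, t y b = T) (S : Finset γ) (hS : ∀ y b, t y b ≠ 0 → y ∈ S) :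
    (∀ ω, ∑ b, p ω * (t (Y ω) b / ∑ b', t (Y ω) b') = p ω) ∧
    (∀ F : γ → β → ℝ, T * ∑ x : Ω × β, p x.1 * (t (Y x.1) x.2 / ∑ b, t (Y x.1) b) * F (Y x.1) x.2 =
      ∑ y, ∑ b, t y b * F y b) ∧
    ∑ ω, Real.negMulLog (p ω) + Real.log T - Real.log S.card ≤
      ∑ x : Ω × β, Real.negMulLog (p x.1 * (t (Y x.1) x.2 / ∑ b, t (Y x.1) b)) := by
  have ht0 : ∀ y b, 0 ≤ t y b := fun y b => by rcases ht y b with h | h <;> simp [h]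
  have hzero : ∀ y, ∑ b, t y b = 0 → ∀ b, t y b = 0 := fun y h b =>
    (Finset.sum_eq_zero_iff_of_nonneg fun b _ => ht0 y b).1 h b (Finset.mem_univ b)
  -- Testing the marginal against the indicator of zero degree shows that such values carry no mass,
  -- so the divisions by zero are harmless.
  have hne : ∀ ω, p ω ≠ 0 → ∑ b, t (Y ω) b ≠ 0 := by
    classical
    intro ω hω h0
    have h1 := hY fun y => if ∑ b, t y b = 0 then 1 else 0
    have h2 : ∑ y, (∑ b, t y b) * (if ∑ b, t y b = 0 then (1 : ℝ) else 0) = 0 :=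
      Finset.sum_eq_zero fun y _ => by split_ifs with h <;> simp [h]
    rw [h2, mul_eq_zero, or_iff_right hT.ne', Finset.sum_eq_zero_iff_of_nonneg] at h1
    · have := h1 ω (Finset.mem_univ _)
      rw [if_pos h0] at this
      exact hω (by simpa using this)
    · intro ω' _
      have := hp ω'
      split_ifs <;> simp [this]
  refine ⟨fun ω => Real.sum_mul_div_sum _ _ (hne ω), fun F => ?_, ?_⟩
  · have h1 := hY fun y => ∑ b, t y b / (∑ b', t y b') * F y b
    have h2 : ∑ x : Ω × β, p x.1 * (t (Y x.1) x.2 / ∑ b, t (Y x.1) b) * F (Y x.1) x.2 =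
        ∑ ω, p ω * ∑ b, t (Y ω) b / (∑ b', t (Y ω) b') * F (Y ω) b := by
      rw [Fintype.sum_prod_type]
      simp only [Finset.mul_sum, mul_assoc]
    rw [h2, h1]
    refine Finset.sum_congr rfl fun y _ => ?_
    rw [Finset.mul_sum]
    refine Finset.sum_congr rfl fun b _ => ?_
    by_cases h : ∑ b, t y b = 0
    · simp [hzero y h b]
    · field_simp
  · rw [Real.sum_negMulLog_extend p (fun ω => t (Y ω)) (fun ω => ht _) hne]
    have h1 := hY fun y => Real.log (∑ b, t y b)
    have h2 := Finset.sum_mul_log_ge S (fun y => ∑ b, t y b) T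
      (fun y => Finset.sum_nonneg fun b _ => ht0 y b) (fun y hy => by
        obtain ⟨b, -, hb⟩ := Finset.exists_ne_zero_of_sum_ne_zero hy
        exact hS y b hb) hsum hT
    rw [← h1] at h2
    have h3 := le_of_mul_le_mul_left h2 hT
    linarith

/-- The neighbour `u` serves only to read off the marginal at `w` from that of an edge. -/
theorem HasTriangleModel.glueTriangleAtVertex (h : H.HasTriangleModel G s)
    (hT : 0 < G.triangleSum) {w u : V} (hwu : H.Adj w u) :
    (H.glueTriangleAtVertex w).HasTriangleModel G
      (s + Real.log G.triangleSum - Real.log (Fintype.card N)) := by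
  obtain ⟨Ω, _, p, X, hp, hp1, hX, hm, hs⟩ := h
  obtain ⟨k1, k2, k3⟩ := entropy_extend (β := N × N) hT hp (X w)
    (fun a x => G.triangleInd a x.1 x.2) (fun _ _ => G.triangleInd_eq _ _ _)
    (fun g => by
      rw [hm w u hwu fun a _ => g a]
      simp only [Fintype.sum_prod_type, Finset.sum_mul])
    (by simp only [Fintype.sum_prod_type, triangleSum]) Finset.univ (fun _ _ _ => Finset.mem_univ _)
  refine ⟨Ω × (N × N), inferInstance, _, Sum.elim (fun v x => X v x.1) fun i x => ![x.2.1, x.2.2] i,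
    fun x => ?_, ?_, ?_, ?_, le_trans ?_ k3⟩
  · exact mul_nonneg (hp _) (div_nonneg (G.triangleInd_nonneg _ _ _)
      (Finset.sum_nonneg fun _ _ => G.triangleInd_nonneg _ _ _))
  · rw [Fintype.sum_prod_type, Finset.sum_congr rfl fun ω _ => k1 ω, hp1]
  · rintro ⟨ω, b, c⟩ ⟨ω', b', c'⟩ h
    have h0 : ω = ω' := hX (funext fun v => congrFun h (Sum.inl v))
    have h1 : b = b' := congrFun h (Sum.inr 0)
    have h2 : c = c' := congrFun h (Sum.inr 1)
    rw [h0, h1, h2]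
  · have hnew : ∀ i j : Fin 3, i ≠ j → ∀ g : N → N → ℝ, G.triangleSum *
        ∑ x : Ω × (N × N), p x.1 * (G.triangleInd (X w x.1) x.2.1 x.2.2 /
          ∑ y : N × N, G.triangleInd (X w x.1) y.1 y.2) *
          g (![X w x.1, x.2.1, x.2.2] i) (![X w x.1, x.2.1, x.2.2] j) =
        ∑ a, ∑ b, ∑ c, G.triangleInd a b c * g a b := by
      intro i j hij g
      rw [k2 fun a x => g (![a, x.1, x.2] i) (![a, x.1, x.2] j), ← G.sum_triangleInd_edge g hij]
      simp only [Fintype.sum_prod_type]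
    have hold : ∀ u v, H.Adj u v → ∀ g : N → N → ℝ, G.triangleSum *
        ∑ x : Ω × (N × N), p x.1 * (G.triangleInd (X w x.1) x.2.1 x.2.2 /
          ∑ y : N × N, G.triangleInd (X w x.1) y.1 y.2) * g (X u x.1) (X v x.1) =
        ∑ a, ∑ b, ∑ c, G.triangleInd a b c * g a b := by
      intro u v huv g
      rw [← hm u v huv g, Fintype.sum_prod_type]
      simp only [← Finset.sum_mul, k1]
    rintro u v huv g
    rw [SimpleGraph.glueTriangleAtVertex, sup_adj, map_adj', fromEdgeSet_adj] at huv
    rcases huv with ⟨-, a, b, hab, rfl, rfl⟩ | ⟨huv, -⟩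
    · exact hold a b hab g
    · simp only [Set.mem_insert_iff, Set.mem_singleton_iff, Sym2.eq_iff] at huv
      rcases huv with (⟨rfl, rfl⟩ | ⟨rfl, rfl⟩) | (⟨rfl, rfl⟩ | ⟨rfl, rfl⟩) |
        (⟨rfl, rfl⟩ | ⟨rfl, rfl⟩)
      · exact hnew 0 1 (by decide) g
      · exact hnew 1 0 (by decide) g
      · exact hnew 0 2 (by decide) g
      · exact hnew 2 0 (by decide) g
      · exact hnew 1 2 (by decide) g
      · exact hnew 2 1 (by decide) g
  · rw [Finset.card_univ]
    linarith

open Classical in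
/-- The ordered adjacent pairs. -/
noncomputable def orderedEdges (G : SimpleGraph N) : Finset (N × N) := {x | G.Adj x.1 x.2}

theorem HasTriangleModel.glueTriangleAtEdge (h : H.HasTriangleModel G s)
    (hT : 0 < G.triangleSum) {x y : V} (hxy : H.Adj x y) :
    (H.glueTriangleAtEdge x y).HasTriangleModel G
      (s + Real.log G.triangleSum - Real.log G.orderedEdges.card) := by
  obtain ⟨Ω, _, p, X, hp, hp1, hX, hm, hs⟩ := h
  obtain ⟨k1, k2, k3⟩ := entropy_extend (β := N) hT hp (fun ω => (X x ω, X y ω))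
    (fun a c => G.triangleInd a.1 a.2 c) (fun _ _ => G.triangleInd_eq _ _ _)
    (fun g => by
      rw [hm x y hxy fun a b => g (a, b)]
      simp only [Fintype.sum_prod_type, Finset.sum_mul])
    (by simp only [Fintype.sum_prod_type, triangleSum]) G.orderedEdges (fun a c h => by
      unfold triangleInd at h
      simp only [ne_eq, ite_eq_right_iff, Classical.not_imp] at h
      simp [orderedEdges, h.1.1])
  refine ⟨Ω × N, inferInstance, _, fun v z => v.elim z.2 fun v => X v z.1,
    fun z => ?_, ?_, ?_, ?_, le_trans ?_ k3⟩
  · exact mul_nonneg (hp _) (div_nonneg (G.triangleInd_nonneg _ _ _)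
      (Finset.sum_nonneg fun _ _ => G.triangleInd_nonneg _ _ _))
  · rw [Fintype.sum_prod_type, Finset.sum_congr rfl fun ω _ => k1 ω, hp1]
  · rintro ⟨ω, c⟩ ⟨ω', c'⟩ h
    have h0 : ω = ω' := hX (funext fun v => congrFun h (some v))
    have h1 : c = c' := congrFun h none
    rw [h0, h1]
  · have hnew : ∀ i j : Fin 3, i ≠ j → ∀ g : N → N → ℝ, G.triangleSum *
        ∑ z : Ω × N, p z.1 * (G.triangleInd (X x z.1) (X y z.1) z.2 /
          ∑ c, G.triangleInd (X x z.1) (X y z.1) c) *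
          g (![X x z.1, X y z.1, z.2] i) (![X x z.1, X y z.1, z.2] j) =
        ∑ a, ∑ b, ∑ c, G.triangleInd a b c * g a b := by
      intro i j hij g
      rw [k2 fun a c => g (![a.1, a.2, c] i) (![a.1, a.2, c] j), ← G.sum_triangleInd_edge g hij]
      simp only [Fintype.sum_prod_type]
    have hold : ∀ u v, H.Adj u v → ∀ g : N → N → ℝ, G.triangleSum *
        ∑ z : Ω × N, p z.1 * (G.triangleInd (X x z.1) (X y z.1) z.2 /
          ∑ c, G.triangleInd (X x z.1) (X y z.1) c) * g (X u z.1) (X v z.1) =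
        ∑ a, ∑ b, ∑ c, G.triangleInd a b c * g a b := by
      intro u v huv g
      rw [← hm u v huv g, Fintype.sum_prod_type]
      simp only [← Finset.sum_mul, k1]
    rintro u v huv g
    rw [SimpleGraph.glueTriangleAtEdge, sup_adj, map_adj', fromEdgeSet_adj] at huv
    rcases huv with ⟨-, a, b, hab, rfl, rfl⟩ | ⟨huv, -⟩
    · exact hold a b hab g
    · simp only [Set.mem_insert_iff, Set.mem_singleton_iff, Sym2.eq_iff] at huv
      rcases huv with (⟨rfl, rfl⟩ | ⟨rfl, rfl⟩) | (⟨rfl, rfl⟩ | ⟨rfl, rfl⟩)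
      · exact hnew 2 0 (by decide) g
      · exact hnew 0 2 (by decide) g
      · exact hnew 2 1 (by decide) g
      · exact hnew 1 2 (by decide) g
  · linarith

/-- Distinct outcomes give distinct maps, so the entropy is at most the log of the number of
outcomes of positive mass, all of which are homomorphisms. -/
theorem HasTriangleModel.le_log_card_hom [Finite V] (h : H.HasTriangleModel G s)
    (hT : 0 < G.triangleSum) :
    0 < Nat.card (H →g G) ∧ s ≤ Real.log (Nat.card (H →g G)) := by
  classical
  obtain ⟨Ω, _, p, X, hp, hp1, hX, hm, hs⟩ := h
  have hadj : ∀ ω, p ω ≠ 0 → ∀ u v, H.Adj u v → G.Adj (X u ω) (X v ω) := by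
    intro ω hω u v huv
    by_contra hn
    -- The indicator of non-adjacency has zero mean over triangles.
    have h1 := hm u v huv fun a b => if G.Adj a b then 0 else 1
    have h2 : ∑ a, ∑ b, ∑ c, G.triangleInd a b c * (if G.Adj a b then (0 : ℝ) else 1) = 0 := by
      refine Finset.sum_eq_zero fun a _ => Finset.sum_eq_zero fun b _ =>
        Finset.sum_eq_zero fun c _ => ?_
      unfold triangleInd
      split_ifs <;> simp_all
    rw [h2, mul_eq_zero, or_iff_right hT.ne', Finset.sum_eq_zero_iff_of_nonneg] at h1
    · have := h1 ω (Finset.mem_univ _)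
      rw [if_neg hn] at this
      exact hω (by simpa using this)
    · intro ω' _
      have := hp ω'
      split_ifs <;> simp [this]
  let S : Finset Ω := {ω | p ω ≠ 0}
  have hne : S.Nonempty := by
    obtain ⟨ω, -, hω⟩ := Finset.exists_ne_zero_of_sum_ne_zero
      (s := Finset.univ) (f := p) (by rw [hp1]; exact one_ne_zero)
    exact ⟨ω, by simpa [S] using hω⟩
  have hcard : S.card ≤ Nat.card (H →g G) := by
    have hfin : Finite (H →g G) := DFunLike.finite _
    rw [← Nat.card_eq_finsetCard S]
    refine Nat.card_le_card_of_injective (fun ω : S =>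
      (⟨fun v => X v ω, fun {u v} huv => hadj ω (Finset.mem_filter.1 ω.2).2 u v huv⟩ : H →g G)) ?_
    intro ω ω' h
    exact Subtype.ext (hX (funext fun v => DFunLike.congr_fun h v))
  have h1 := Finset.sum_mul_log_ge S p 1 hp (fun ω h => by simpa [S] using h) hp1 one_pos
  rw [Real.log_one, zero_sub, one_mul] at h1
  simp only [Real.negMulLog, neg_mul, Finset.sum_neg_distrib] at hs
  refine ⟨hne.card_pos.trans_le hcard, le_trans (by linarith)
    (Real.log_le_log (by exact_mod_cast hne.card_pos) (by exact_mod_cast hcard))⟩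

end Model

/-! ### Parameters of triangle-trees. -/

section Structure

variable {V V' : Type u} {H : SimpleGraph V} {H' : SimpleGraph V'}

theorem Iso.ncard_edgeSet_eq (e : H ≃g H') : H'.edgeSet.ncard = H.edgeSet.ncard :=
  (Nat.card_congr e.mapEdgeSet).symm

theorem ncard_edgeSet_map [Finite V] (f : V ↪ V') : (H.map f).edgeSet.ncard = H.edgeSet.ncard := by
  rw [edgeSet_map, Set.ncard_image_of_injective _ f.sym2Map.injective]

theorem ncard_edgeSet_glueTriangleAtVertex [Finite V] (H : SimpleGraph V) (w : V) :
    (H.glueTriangleAtVertex w).edgeSet.ncard = H.edgeSet.ncard + 3 := by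
  have h1 := ncard_edgeSet_map (H := H) (Function.Embedding.inl : V ↪ V ⊕ Fin 2)
  have h2 : ({s(Sum.inl w, Sum.inr 0), s(Sum.inl w, Sum.inr 1), s(Sum.inr 0, Sum.inr 1)} :
      Set (Sym2 (V ⊕ Fin 2))).ncard = 3 := by
    rw [Set.ncard_eq_three]
    exact ⟨_, _, _, by simp, by simp, by simp, rfl⟩
  rw [← h1, ← h2, glueTriangleAtVertex, edgeSet_sup, edgeSet_fromEdgeSet,
    sdiff_eq_left.2 (by rw [Set.disjoint_left]; rintro x (rfl | rfl | rfl) <;> simp)]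
  refine Set.ncard_union_eq ?_ (Set.toFinite _) (Set.toFinite _)
  rw [show (H.map Sum.inl).edgeSet = _ from
    edgeSet_map (Function.Embedding.inl : V ↪ V ⊕ Fin 2) H, Set.disjoint_right]
  rintro x (rfl | rfl | rfl) <;> rintro ⟨y, -, hy⟩ <;> induction y <;> simp at hy

theorem ncard_edgeSet_glueTriangleAtEdge [Finite V] (H : SimpleGraph V) {x y : V} (hxy : x ≠ y) :
    (H.glueTriangleAtEdge x y).edgeSet.ncard = H.edgeSet.ncard + 2 := by
  have h1 := ncard_edgeSet_map (H := H) (Function.Embedding.some : V ↪ Option V)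
  have h2 : ({s(none, some x), s(none, some y)} : Set (Sym2 (Option V))).ncard = 2 := by
    rw [Set.ncard_eq_two]
    exact ⟨_, _, by simpa using hxy, rfl⟩
  rw [← h1, ← h2, glueTriangleAtEdge, edgeSet_sup, edgeSet_fromEdgeSet,
    sdiff_eq_left.2 (by rw [Set.disjoint_left]; rintro x (rfl | rfl) <;> simp)]
  refine Set.ncard_union_eq ?_ (Set.toFinite _) (Set.toFinite _)
  rw [show (H.map some).edgeSet = _ from
    edgeSet_map (Function.Embedding.some : V ↪ Option V) H, Set.disjoint_right]
  rintro x (rfl | rfl) <;> rintro ⟨y, -, hy⟩ <;> induction y <;> simp at hy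

theorem exists_adj_glueTriangleAtVertex (h : ∀ v, ∃ u, H.Adj v u) (w : V) (v : V ⊕ Fin 2) :
    ∃ u, (H.glueTriangleAtVertex w).Adj v u := by
  simp only [glueTriangleAtVertex, sup_adj, map_adj', fromEdgeSet_adj]
  rcases v with v | i
  · obtain ⟨u, hu⟩ := h v
    exact ⟨Sum.inl u, Or.inl ⟨by simpa using hu.ne, v, u, hu, rfl, rfl⟩⟩
  · refine ⟨Sum.inl w, Or.inr ⟨?_, by simp⟩⟩
    fin_cases i <;> simp

theorem exists_adj_glueTriangleAtEdge (h : ∀ v, ∃ u, H.Adj v u) (x y : V) (v : Option V) :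
    ∃ u, (H.glueTriangleAtEdge x y).Adj v u := by
  simp only [glueTriangleAtEdge, sup_adj, map_adj', fromEdgeSet_adj]
  rcases v with _ | v
  · exact ⟨some x, Or.inr ⟨by simp, by simp⟩⟩
  · obtain ⟨u, hu⟩ := h v
    exact ⟨some u, Or.inl ⟨by simpa using hu.ne, v, u, hu, rfl, rfl⟩⟩

/-- A triangle-tree has a number `m` of triangles and a number `b` of gluings along edges which
determine its numbers of vertices and edges and the entropy of its triangle models. -/
theorem IsTriangleTree.exists_triangleModel (hH : H.IsTriangleTree) :
    Finite V ∧ (∀ v, ∃ u, H.Adj v u) ∧ ∃ m b : ℕ, b + 1 ≤ m ∧ H.edgeSet.ncard + b = 3 * m ∧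
      Nat.card V + b = 2 * m + 1 ∧
      ∀ {N : Type} [Fintype N] (G : SimpleGraph N), 0 < G.triangleSum →
        H.HasTriangleModel G (m * Real.log G.triangleSum -
          (m - 1 - b) * Real.log (Fintype.card N) - b * Real.log G.orderedEdges.card) := by
  induction hH with
  | @triangle V H e =>
    have hf : Finite V := Finite.of_equiv _ e.toEquiv
    have hfin3 : ∀ v : Fin 3, ∃ u, (⊤ : SimpleGraph (Fin 3)).Adj v u := by decide
    refine ⟨hf, fun v => ?_, 1, 0, le_rfl, ?_, ?_, fun G hT => ?_⟩
    · obtain ⟨u, hu⟩ := hfin3 (e.symm v)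
      exact ⟨e u, by simpa using e.map_rel_iff.2 hu⟩
    · rw [← Nat.card_coe_set_eq, ← Nat.card_congr e.mapEdgeSet, Nat.card_coe_set_eq,
        ← coe_edgeFinset, Set.ncard_coe_finset]
      rfl
    · simp [← Nat.card_congr e.toEquiv]
    · convert (hasTriangleModel_triangle hT).iso e using 1
      simp
  | @glueVertex V V' H H' hH w e ih =>
    obtain ⟨hf, hadj, m, b, hbm, hE, hV, hM⟩ := ih
    have hf' : Finite V' := Finite.of_equiv _ e.toEquiv
    refine ⟨hf', fun v => ?_, m + 1, b, by omega, ?_, ?_, fun G hT => ?_⟩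
    · obtain ⟨u, hu⟩ := exists_adj_glueTriangleAtVertex hadj w (e.symm v)
      exact ⟨e u, by simpa using e.map_rel_iff.2 hu⟩
    · rw [e.ncard_edgeSet_eq, ncard_edgeSet_glueTriangleAtVertex]
      omega
    · rw [← Nat.card_congr e.toEquiv, Nat.card_sum]
      simp
      omega
    · obtain ⟨u, hu⟩ := hadj w
      convert ((hM G hT).glueTriangleAtVertex hT hu).iso e using 1
      push_cast
      ring
  | @glueEdge V V' H H' hH x y hxy e ih =>
    obtain ⟨hf, hadj, m, b, hbm, hE, hV, hM⟩ := ih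
    have hf' : Finite V' := Finite.of_equiv _ e.toEquiv
    refine ⟨hf', fun v => ?_, m + 1, b + 1, by omega, ?_, ?_, fun G hT => ?_⟩
    · obtain ⟨u, hu⟩ := exists_adj_glueTriangleAtEdge hadj x y (e.symm v)
      exact ⟨e u, by simpa using e.map_rel_iff.2 hu⟩
    · rw [e.ncard_edgeSet_eq, ncard_edgeSet_glueTriangleAtEdge H hxy.ne]
      omega
    · rw [← Nat.card_congr e.toEquiv, Finite.card_option]
      omega
    · convert ((hM G hT).glueTriangleAtEdge hT hxy).iso e using 1
      push_cast
      ring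

end Structure

/-! ### Linearised lower bound on homomorphism density. -/

section Density

/-- Tangent plane at `(1,1)` of `X^m / Y^b`, convex because `m ≥ b + 1`. The proof combines `log t ≤
t - 1` at `A/X` and `Y/X` with `X - 1 ≤ X log X`, the last taken with weight `m - 1 - b`. -/
theorem _root_.Real.tangent_le_pow_div_pow {X Y A : ℝ} {m b : ℕ} (hbm : b + 1 ≤ m) (hX : 0 < X)
    (hY : 0 < Y) (hA : 0 < A) (h : m * Real.log X - b * Real.log Y ≤ Real.log A) :
    m * X - b * Y + (1 - m + b) ≤ A := by
  have hbm' : (b : ℝ) + 1 ≤ m := by exact_mod_cast hbm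
  have h1 := Real.log_le_sub_one_of_pos (div_pos hA hX)
  rw [Real.log_div hA.ne' hX.ne'] at h1
  have h2 := Real.log_le_sub_one_of_pos (div_pos hY hX)
  rw [Real.log_div hY.ne' hX.ne'] at h2
  have h3 := Real.self_sub_one_le_mul_log hX.le
  have f1 := mul_le_mul_of_nonneg_left h1 hX.le
  have f2 := mul_le_mul_of_nonneg_left h2 hX.le
  rw [mul_sub X (_ / X), mul_div_cancel₀ _ hX.ne'] at f1 f2
  have f3 := mul_le_mul_of_nonneg_left h3 (by linarith : (0 : ℝ) ≤ m - 1 - b)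
  have f4 := mul_le_mul_of_nonneg_left f2 (Nat.cast_nonneg (α := ℝ) b)
  have f5 := mul_le_mul_of_nonneg_left h hX.le
  linarith

variable {N : Type} [Fintype N]

theorem triangleSum_nonneg (G : SimpleGraph N) : 0 ≤ G.triangleSum :=
  Finset.sum_nonneg fun _ _ => Finset.sum_nonneg fun _ _ => Finset.sum_nonneg fun _ _ =>
    G.triangleInd_nonneg _ _ _

theorem orderedEdges_card_pos {G : SimpleGraph N} (hT : 0 < G.triangleSum) :
    0 < G.orderedEdges.card := by
  rw [Finset.card_pos]
  by_contra h
  rw [Finset.not_nonempty_iff_eq_empty, Finset.eq_empty_iff_forall_notMem] at h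
  refine hT.ne' (Finset.sum_eq_zero fun a _ => Finset.sum_eq_zero fun b _ =>
    Finset.sum_eq_zero fun c _ => if_neg fun hc => h (a, b) ?_)
  simp [orderedEdges, hc.1]

/-- A linear lower bound on the homomorphism density, tangent at the densities of a random
graph. -/
theorem hom_density_ge {V : Type u} [Finite V] {H : SimpleGraph V} {m b : ℕ} (hbm : b + 1 ≤ m)
    (hV : Nat.card V + b = 2 * m + 1) (G : SimpleGraph N) [Nonempty N]
    (hM : 0 < G.triangleSum → H.HasTriangleModel G (m * Real.log G.triangleSum -
          (m - 1 - b) * Real.log (Fintype.card N) - b * Real.log G.orderedEdges.card)) :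
    (2 : ℝ) ^ b / 8 ^ m * (m * (8 * G.triangleSum / Fintype.card N ^ 3) -
      b * (2 * G.orderedEdges.card / Fintype.card N ^ 2) + (1 - m + b)) ≤
      Nat.card (H →g G) / Fintype.card N ^ Nat.card V := by
  have hn : (0 : ℝ) < Fintype.card N := by exact_mod_cast Fintype.card_pos
  set n : ℝ := (Fintype.card N : ℝ)
  have hbm' : (b : ℝ) + 1 ≤ m := by exact_mod_cast hbm
  rcases G.triangleSum_nonneg.eq_or_lt with hT | hT
  -- Without triangles the linear bound is nonpositive, since `1 - m + b ≤ 0`.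
  · refine le_trans (mul_nonpos_of_nonneg_of_nonpos (by positivity) ?_) (by positivity)
    rw [← hT]
    have : 0 ≤ (b : ℝ) * (2 * G.orderedEdges.card / n ^ 2) := by positivity
    simp
    linarith
  · obtain ⟨h0, h1⟩ := (hM hT).le_log_card_hom hT
    have hE : (0 : ℝ) < G.orderedEdges.card := by exact_mod_cast orderedEdges_card_pos hT
    have h0' : (0 : ℝ) < Nat.card (H →g G) := by exact_mod_cast h0
    have hV' : (Nat.card V : ℝ) = 2 * m + 1 - b := by
      rw [eq_sub_iff_add_eq]; exact_mod_cast hV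
    rw [mul_comm, ← le_div_iff₀ (by positivity)]
    refine Real.tangent_le_pow_div_pow hbm (by positivity) (by positivity) (by positivity) ?_
    rw [Real.log_div (by positivity) (by positivity), Real.log_mul (by norm_num) hT.ne',
      Real.log_div (by positivity) (by positivity), Real.log_mul (by norm_num) hE.ne',
      Real.log_div (by positivity) (by positivity), Real.log_div (by positivity) (by positivity),
      Real.log_div (by positivity) (by positivity)]
    simp only [Real.log_pow]
    rw [hV']
    push_cast
    linarith

end Density

/-! ### Goodman's inequality. -/

section Goodman

variable {N : Type}

open Classical in
/-- The signed adjacency: `1` on edges, `-1` on non-edges, `0` on the diagonal. -/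
noncomputable def signedAdj (G : SimpleGraph N) (a b : N) : ℝ :=
  if a = b then 0 else if G.Adj a b then 1 else -1

variable (G : SimpleGraph N)

theorem signedAdj_comm (a b : N) : G.signedAdj a b = G.signedAdj b a := by
  unfold signedAdj
  by_cases h : a = b
  · simp [h]
  · rw [if_neg h, if_neg (Ne.symm h)]
    congr 1
    exact propext (G.adj_comm a b)

open Classical in
-- For distinct vertices with pair signs `x`, `y`, `z`, the quantity `(1 + xy + yz + zx)/4` is
-- exactly the indicator of a monochromatic triangle; the subtracted terms absorb coincidences.
theorem triangleInd_add_triangleInd_compl_ge (a b c : N) :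
    (1 + G.signedAdj a b * G.signedAdj a c + G.signedAdj b a * G.signedAdj b c +
      G.signedAdj c a * G.signedAdj c b) / 4 -
      ((if a = b then 1 else 0) + (if b = c then 1 else 0) + (if a = c then 1 else 0)) ≤
      G.triangleInd a b c + Gᶜ.triangleInd a b c := by
  rw [G.signedAdj_comm b a, G.signedAdj_comm c a, G.signedAdj_comm c b]
  unfold signedAdj triangleInd
  simp only [compl_adj]
  by_cases hab : a = b
  · subst hab
    by_cases hac : a = c
    · subst hac; simp; norm_num
    · by_cases h : G.Adj a c <;> simp [hac, h] <;> norm_num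
  by_cases hac : a = c
  · subst hac
    by_cases h : G.Adj a b <;> simp [hab, h, Ne.symm hab, G.adj_comm b a] <;> norm_num
  by_cases hbc : b = c
  · subst hbc
    by_cases h : G.Adj a b <;> simp [hab, h] <;> norm_num
  by_cases h1 : G.Adj a b <;> by_cases h2 : G.Adj a c <;> by_cases h3 : G.Adj b c <;>
    simp [hab, hac, hbc, h1, h2, h3] <;> norm_num

variable [Fintype N]

theorem goodman : (Fintype.card N : ℝ) ^ 3 / 4 - 3 * (Fintype.card N : ℝ) ^ 2 ≤
    G.triangleSum + Gᶜ.triangleSum := by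
  classical
  have h := Finset.sum_le_sum fun a (_ : a ∈ Finset.univ) =>
    Finset.sum_le_sum fun b (_ : b ∈ Finset.univ) =>
    Finset.sum_le_sum fun c (_ : c ∈ Finset.univ) => G.triangleInd_add_triangleInd_compl_ge a b c
  -- Each sign-product sum is a sum of squared signed degrees, hence may be dropped.
  have hsq : 0 ≤ ∑ a, (∑ b, G.signedAdj a b) * ∑ c, G.signedAdj a c :=
    Finset.sum_nonneg fun a _ => mul_self_nonneg _
  have h1 : ∑ a, ∑ b, ∑ c, G.signedAdj a b * G.signedAdj a c =
      ∑ a, (∑ b, G.signedAdj a b) * ∑ c, G.signedAdj a c := by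
    simp only [Finset.sum_mul_sum]
  have h2 : ∑ a, ∑ b, ∑ c, G.signedAdj b a * G.signedAdj b c =
      ∑ a, (∑ b, G.signedAdj a b) * ∑ c, G.signedAdj a c := by
    rw [Finset.sum_comm, ← h1]
  have h3 : ∑ a, ∑ b, ∑ c, G.signedAdj c a * G.signedAdj c b =
      ∑ a, (∑ b, G.signedAdj a b) * ∑ c, G.signedAdj a c := by
    rw [← h1, Finset.sum_congr rfl fun a _ => Finset.sum_comm, Finset.sum_comm]
  simp only [Finset.sum_sub_distrib, Finset.sum_add_distrib, ← Finset.sum_div, h1, h2, h3] at h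
  simp at h
  unfold triangleSum
  nlinarith

theorem orderedEdges_card_add_compl_le :
    (G.orderedEdges.card : ℝ) + Gᶜ.orderedEdges.card ≤ (Fintype.card N : ℝ) ^ 2 := by
  classical
  have h : Disjoint G.orderedEdges Gᶜ.orderedEdges := by
    rw [Finset.disjoint_left]
    intro x h1 h2
    simp only [orderedEdges, Finset.mem_filter, compl_adj] at h1 h2
    exact h2.2.2 h1.2
  have h1 := Finset.card_le_univ (G.orderedEdges ∪ Gᶜ.orderedEdges)
  rw [Finset.card_union_of_disjoint h, Fintype.card_prod, ← sq] at h1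
  exact_mod_cast h1

end Goodman

/-! ### From homomorphisms to embeddings, and the random colouring. -/

section Counting

variable {V : Type u} [Finite V] {H : SimpleGraph V} {n : ℕ}

theorem _root_.Nat.card_embedding_fin (V : Type u) [Finite V] (n : ℕ) :
    Nat.card (V ↪ Fin n) = n.descFactorial (Nat.card V) := by
  have := Fintype.ofFinite V
  rw [Nat.card_eq_fintype_card, Fintype.card_embedding_eq, Fintype.card_fin,
    Nat.card_eq_fintype_card]

/-- Non-injective homomorphisms are among the `n^v - n(n-1)⋯(n-v+1)` non-injective maps; the
additive form avoids truncated subtraction. -/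
theorem card_hom_le_add (G : SimpleGraph (Fin n)) :
    Nat.card (H →g G) + n.descFactorial (Nat.card V) ≤
      {f : V ↪ Fin n | ∀ u v, H.Adj u v → G.Adj (f u) (f v)}.ncard + n ^ Nat.card V := by
  have h1 : Nat.card (V → Fin n) = n ^ Nat.card V := by rw [Nat.card_fun, Nat.card_fin]
  have hfin : Finite (H →g G) := DFunLike.finite _
  rw [← Nat.card_embedding_fin, ← h1, ← Nat.card_coe_set_eq, ← Nat.card_sum, ← Nat.card_sum]
  classical
  refine Nat.card_le_card_of_injective (Sum.elim
    (fun φ => if h : Function.Injective φ then Sum.inl ⟨⟨φ, h⟩, fun _ _ huv => φ.map_adj huv⟩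
      else Sum.inr φ) fun f => Sum.inr f) ?_
  rintro (φ | f) (ψ | g) h
  · simp only [Sum.elim_inl] at h
    split_ifs at h with h1 h2 h2
    · simp only [Sum.inl.injEq, Subtype.mk.injEq, Function.Embedding.mk.injEq] at h
      rw [DFunLike.coe_injective h]
    · simp only [Sum.inr.injEq] at h
      rw [DFunLike.coe_injective h]
  · simp only [Sum.elim_inl, Sum.elim_inr] at h
    split_ifs at h with h1
    simp only [Sum.inr.injEq] at h
    exact absurd (h ▸ g.injective) h1
  · simp only [Sum.elim_inl, Sum.elim_inr] at h
    split_ifs at h with h1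
    simp only [Sum.inr.injEq] at h
    exact absurd (h ▸ f.injective) h1
  · simpa using h

theorem compl_labelGraph_zero (C : TopEdgeLabeling (Fin n) (Fin 2)) :
    (C.labelGraph 0)ᶜ = C.labelGraph 1 := by
  ext a b
  rw [compl_adj, TopEdgeLabeling.labelGraph_adj, TopEdgeLabeling.labelGraph_adj]
  by_cases h : a = b
  · simp [h]
  · simp only [ne_eq, h, not_false_eq_true, exists_true_left, true_and]
    omega

theorem card_hom_add_card_hom_le (hH : ∃ u v, H.Adj u v) (C : TopEdgeLabeling (Fin n) (Fin 2)) :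
    Nat.card (H →g C.labelGraph 0) + Nat.card (H →g (C.labelGraph 0)ᶜ) +
      2 * n.descFactorial (Nat.card V) ≤ H.monoCopyCount C + 2 * n ^ Nat.card V := by
  obtain ⟨u, v, huv⟩ := hH
  have h0 := card_hom_le_add (H := H) (C.labelGraph 0)
  have h1 := card_hom_le_add (H := H) (C.labelGraph 0)ᶜ
  have h2 : H.monoCopyCount C =
      ({f : V ↪ Fin n | ∀ u v, H.Adj u v → (C.labelGraph 0).Adj (f u) (f v)} ∪
      {f : V ↪ Fin n | ∀ u v, H.Adj u v → (C.labelGraph 0)ᶜ.Adj (f u) (f v)}).ncard := by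
    rw [compl_labelGraph_zero, ← Nat.card_coe_set_eq, monoCopyCount]
    refine Nat.card_congr (Equiv.subtypeEquivRight fun f => ?_)
    rw [Fin.exists_fin_two]
    rfl
  -- An edge of `H` prevents one embedding from being monochromatic in both colours.
  rw [Set.ncard_union_eq ?_ (Set.toFinite _) (Set.toFinite _)] at h2
  · omega
  · rw [Set.disjoint_left]
    intro f hf hf'
    exact ((compl_adj _ _ _).1 (hf' u v huv)).2 (hf u v huv)

/-- Overwriting `g` on the range of `φ` by arbitrary values is injective, as `g` was constant there.
-/
theorem _root_.Function.card_const_comp_mul_le {α β K : Type*} [Finite α] [Finite β] [Finite K]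
    (φ : α → β) (hφ : Function.Injective φ) (c : K) :
    Nat.card {g : β → K // ∀ a, g (φ a) = c} * Nat.card K ^ Nat.card α ≤
      Nat.card K ^ Nat.card β := by
  rw [← Nat.card_fun, ← Nat.card_fun, ← Nat.card_prod]
  refine Nat.card_le_card_of_injective (fun x => Function.extend φ x.2 x.1) ?_
  rintro ⟨⟨g, hg⟩, h⟩ ⟨⟨g', hg'⟩, h'⟩ heq
  have h1 : h = h' := by
    funext a
    simpa [hφ.extend_apply] using congrFun heq (φ a)
  have h2 : g = g' := by
    funext b
    by_cases hb : ∃ a, φ a = b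
    · obtain ⟨a, rfl⟩ := hb
      rw [hg, hg']
    · simpa [Function.extend_apply' _ _ _ hb] using congrFun heq b
  simp [h1, h2]

theorem card_labeling_mono_mul_le (f : V ↪ Fin n) (c : Fin 2) :
    Nat.card {C : TopEdgeLabeling (Fin n) (Fin 2) //
      ∀ u v, H.Adj u v → (C.labelGraph c).Adj (f u) (f v)} * 2 ^ H.edgeSet.ncard ≤
      Nat.card (TopEdgeLabeling (Fin n) (Fin 2)) := by
  let F : H →g (⊤ : SimpleGraph (Fin n)) := ⟨f, fun {u v} h => by simpa using h.ne⟩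
  have h := Function.card_const_comp_mul_le F.mapEdgeSet
    (Hom.mapEdgeSet.injective F f.injective) c
  rw [Nat.card_fin] at h
  have hcard : Nat.card (TopEdgeLabeling (Fin n) (Fin 2)) =
      2 ^ Nat.card (⊤ : SimpleGraph (Fin n)).edgeSet := by
    rw [← Nat.card_fin 2, ← Nat.card_fun, Nat.card_fin]
    rfl
  rw [hcard]
  refine le_trans (Nat.mul_le_mul_right _ ?_) h
  refine Nat.card_le_card_of_injective (fun C => ⟨C.1, ?_⟩) fun C C' hCC' => Subtype.ext ?_
  · rintro ⟨e, he⟩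
    induction e with | _ u v
    obtain ⟨_, h⟩ := (EdgeLabeling.labelGraph_adj _ _).1 (C.2 u v he)
    exact h
  · have hval := congrArg Subtype.val hCC'
    exact hval

/-- First-moment argument: double count pairs of a colouring and an embedding, separately for each
colour. -/
theorem ramseyMultiplicity_mul_le (H : SimpleGraph V) (n : ℕ) :
    H.ramseyMultiplicity n * 2 ^ H.edgeSet.ncard ≤ 2 * n.descFactorial (Nat.card V) := by
  classical
  have := Fintype.ofFinite V
  have : Fintype (TopEdgeLabeling (Fin n) (Fin 2)) := Fintype.ofFinite _
  set M := Fintype.card (TopEdgeLabeling (Fin n) (Fin 2)) with hM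
  have hMpos : 0 < M := Fintype.card_pos
  let P (C : TopEdgeLabeling (Fin n) (Fin 2)) (f : V ↪ Fin n) (c : Fin 2) : Prop :=
    ∀ u v, H.Adj u v → (C.labelGraph c).Adj (f u) (f v)
  have h1 : M * H.ramseyMultiplicity n ≤ ∑ C : TopEdgeLabeling (Fin n) (Fin 2), H.monoCopyCount C := by
    rw [hM, ← Finset.card_univ, ← smul_eq_mul]
    exact Finset.card_nsmul_le_sum _ _ _ fun C _ => ciInf_le (OrderBot.bddBelow _) C
  have h2 : ∀ C, H.monoCopyCount C ≤ ∑ f, ∑ c, if P C f c then 1 else 0 := by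
    intro C
    rw [monoCopyCount, Nat.card_eq_fintype_card, Fintype.card_subtype, Finset.card_filter]
    refine Finset.sum_le_sum fun f _ => ?_
    split_ifs with h
    · obtain ⟨c, hc⟩ := h
      refine le_trans ?_ (Finset.single_le_sum (fun _ _ => Nat.zero_le _) (Finset.mem_univ c))
      rw [if_pos hc]
    · exact Nat.zero_le _
  have h3 : ∀ f c, (∑ C : TopEdgeLabeling (Fin n) (Fin 2), if P C f c then 1 else 0) * 2 ^ H.edgeSet.ncard ≤ M := by
    intro f c
    have hle := card_labeling_mono_mul_le (H := H) f c
    rwa [Nat.card_eq_fintype_card, Nat.card_eq_fintype_card, Fintype.card_subtype,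
      Finset.card_filter] at hle
  have h4 : ∑ C : TopEdgeLabeling (Fin n) (Fin 2), H.monoCopyCount C ≤ ∑ f, ∑ c, ∑ C : TopEdgeLabeling (Fin n) (Fin 2), if P C f c then 1 else 0 := by
    refine (Finset.sum_le_sum fun C _ => h2 C).trans (le_of_eq ?_)
    rw [Finset.sum_comm]
    exact Finset.sum_congr rfl fun f _ => Finset.sum_comm
  have h5 : (∑ f, ∑ c, ∑ C : TopEdgeLabeling (Fin n) (Fin 2), if P C f c then 1 else 0) * 2 ^ H.edgeSet.ncard ≤
      n.descFactorial (Nat.card V) * (2 * M) := by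
    simp only [Finset.sum_mul]
    refine (Finset.sum_le_sum fun f _ => Finset.sum_le_sum fun c _ =>
      (Finset.sum_mul _ _ _).symm.trans_le (h3 f c)).trans (le_of_eq ?_)
    simp only [Finset.sum_const, Finset.card_univ, Fintype.card_fin, smul_eq_mul,
      Fintype.card_embedding_eq, Nat.card_eq_fintype_card]
  refine Nat.le_of_mul_le_mul_left ?_ hMpos
  calc M * (H.ramseyMultiplicity n * 2 ^ H.edgeSet.ncard)
      = M * H.ramseyMultiplicity n * 2 ^ H.edgeSet.ncard := (mul_assoc _ _ _).symm
    _ ≤ (∑ f, ∑ c, ∑ C : TopEdgeLabeling (Fin n) (Fin 2), if P C f c then 1 else 0) * 2 ^ H.edgeSet.ncard :=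
        Nat.mul_le_mul_right _ (h1.trans h4)
    _ ≤ n.descFactorial (Nat.card V) * (2 * M) := h5
    _ = M * (2 * n.descFactorial (Nat.card V)) := by ring

end Counting

end SimpleGraph

/-! ### Squeezing the normalised multiplicity. -/

theorem theorem1p1 {V : Type u} [Finite V] (H : SimpleGraph V) (hH : H.IsTriangleTree) :
    H.IsCommon := by
  obtain ⟨-, hadj, m, b, hbm, hE, hV, hM⟩ := hH.exists_triangleModel
  have hne : Nonempty V := by
    have : 0 < Nat.card V := by omega
    exact (Nat.card_pos_iff.1 this).1
  have hedge : ∃ u v, H.Adj u v := ⟨hne.some, hadj _⟩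
  set v := Nat.card V with hv
  have hvpos : 0 < v := by omega
  set L : ℝ := 2 ^ b / 8 ^ m with hL
  have hLe : (2 : ℝ) ^ (1 - (H.edgeSet.ncard : ℤ)) = 2 * L := by
    have h8 : (8 : ℝ) ^ m = 2 ^ H.edgeSet.ncard * 2 ^ b := by
      rw [← pow_add, hE, pow_mul]
      norm_num
    rw [hL, h8, zpow_sub₀ two_ne_zero, zpow_one, zpow_natCast]
    field_simp
  rw [SimpleGraph.IsCommon, hLe]
  have hratio : Tendsto (fun n : ℕ => (n : ℝ) ^ v / n.descFactorial v) atTop (𝓝 1) := by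
    refine (Asymptotics.isEquivalent_iff_tendsto_one ?_).1 (isEquivalent_descFactorial v).symm
    filter_upwards [eventually_ge_atTop v] with n hn
    exact_mod_cast (Nat.descFactorial_pos.2 hn).ne'
  -- The `- 2` and `+ 2` account for the non-injective maps in the two colours; `24 m / n` is the
  -- Goodman error `3n²` scaled by `8/n³` and weighted by `m`.
  have hlow : Tendsto (fun n : ℕ => (n : ℝ) ^ v / n.descFactorial v *
      (L * (2 - 24 * m / n) - 2) + 2) atTop (𝓝 (2 * L)) := by
    have h := (hratio.mul ((((tendsto_const_div_atTop_nhds_zero_nat (24 * m : ℝ)).const_sub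
      2).const_mul L).sub_const 2)).add_const 2
    convert h using 2
    ring
  refine tendsto_of_tendsto_of_tendsto_of_le_of_le' hlow tendsto_const_nhds ?_ ?_
  · filter_upwards [eventually_ge_atTop v] with n hn
    have hnpos : 0 < n := hvpos.trans_le hn
    have hN : Nonempty (Fin n) := ⟨⟨0, hnpos⟩⟩
    have hn0 : (0 : ℝ) < n := by exact_mod_cast hnpos
    have hd : (0 : ℝ) < n.descFactorial v := by exact_mod_cast Nat.descFactorial_pos.2 hn
    obtain ⟨C, hC⟩ := exists_eq_ciInf_of_finite
      (f := fun C : SimpleGraph.TopEdgeLabeling (Fin n) (Fin 2) => H.monoCopyCount C)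
    rw [SimpleGraph.ramseyMultiplicity, ← hC]
    have h1 := SimpleGraph.card_hom_add_card_hom_le hedge C
    set G := C.labelGraph 0
    have h2 := SimpleGraph.hom_density_ge hbm hV G (hM G)
    have h3 := SimpleGraph.hom_density_ge hbm hV Gᶜ (hM Gᶜ)
    have h4 := G.goodman
    have h5 := G.orderedEdges_card_add_compl_le
    rw [Fintype.card_fin] at h2 h3 h4 h5
    rw [← hL, ← hv] at h2 h3
    have h6 : 8 * G.triangleSum / n ^ 3 + 8 * Gᶜ.triangleSum / n ^ 3 ≥ 2 - 24 / n := by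
      have : (2 : ℝ) - 24 / n = 8 * ((n : ℝ) ^ 3 / 4 - 3 * (n : ℝ) ^ 2) / n ^ 3 := by
        field_simp
        ring
      rw [this, ← add_div, ← mul_add]
      gcongr
    have h7 : 2 * (G.orderedEdges.card : ℝ) / n ^ 2 + 2 * Gᶜ.orderedEdges.card / n ^ 2 ≤ 2 := by
      rw [← add_div, ← mul_add, div_le_iff₀ (by positivity)]
      linarith
    have h8 : L * (2 - 24 * m / n) ≤
        Nat.card (H →g G) / (n : ℝ) ^ v + Nat.card (H →g Gᶜ) / (n : ℝ) ^ v := by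
      -- The constants combine to `2m - 2b + 2(1 - m + b) = 2`.
      refine le_trans ?_ (add_le_add h2 h3)
      rw [← mul_add]
      refine mul_le_mul_of_nonneg_left ?_ (by positivity)
      have h6' := mul_le_mul_of_nonneg_left h6 (Nat.cast_nonneg (α := ℝ) m)
      have h7' := mul_le_mul_of_nonneg_left h7 (Nat.cast_nonneg (α := ℝ) b)
      have : (24 : ℝ) * m / n = m * (24 / n) := by ring
      linarith
    rw [← add_div, le_div_iff₀ (by positivity)] at h8
    have h1' : (Nat.card (H →g G) : ℝ) + Nat.card (H →g Gᶜ) + 2 * n.descFactorial v ≤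
        H.monoCopyCount C + 2 * (n : ℝ) ^ v := by exact_mod_cast h1
    rw [le_div_iff₀ hd]
    have : ((n : ℝ) ^ v / n.descFactorial v * (L * (2 - 24 * m / n) - 2) + 2) *
        n.descFactorial v = L * (2 - 24 * m / n) * n ^ v - 2 * n ^ v + 2 * n.descFactorial v := by
      field_simp
    linarith
  · filter_upwards with n
    rw [← hLe, zpow_sub₀ two_ne_zero, zpow_one, zpow_natCast]
    refine div_le_of_le_mul₀ (by positivity) (by positivity) ?_
    rw [div_mul_eq_mul_div, le_div_iff₀ (by positivity)]
    exact_mod_cast H.ramseyMultiplicity_mul_le n
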